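/- Let $(\mathcal R,\mu)$ be a $\sigma$-finite measure space, and let $\mathcal M$ be the set of ($\mu$-a.e. classes of) measurable functions on $\mathcal R$ with values in the extended complex numbers $\mathbb C\cup\{\infty\}$. For $f\in\mathcal M$ let $f^*(t)=\inf\{s\in[0,\infty):\mu(\{|f|>s\})\le t\}$, $t\ge 0$, be its non-increasing rearrangement; $f,g\in\mathcal M$ are equimeasurable if $f^*=g^*$. Assume that $(\mathcal R,\mu)$ is resonant, i.e. for all $f,g\in\mathcal M$, $$\sup\Big\{\int_{\mathcal R}|f\tilde g|\,d\mu:\ \tilde g\in\mathcal M,\ \tilde g^*=g^*\Big\}=\int_0^\infty f^*(t)g^*(t)\,dt .$$ A Banach function norm is a map $\|\cdot\|_X:\mathcal M\to[0,\infty]$ with $\|f\|_X=\||f|\|_X$ which on non-negative functions is absolutely homogeneous, subadditive, vanishes exactly at $f=0$ a.e., is monotone ($f\le g$ a.e. implies $\|f\|_X\le\|g\|_X$), has the Fatou property ($f_n\uparrow f$ a.e. implies $\|f_n\|_X\uparrow\|f\|_X$), and is such that for every measurable $E$ with $\mu(E)<\infty$ one has $\|\chi_E\|_X<\infty$ and there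 is $C_E<\infty$ with $\int_E f\,d\mu\le C_E\|f\|_X$ for all $f\ge 0$. It is rearrangement-invariant (r.i.) if equimeasurable functions have equal norms; then $X=\{f\in\mathcal M:\|f\|_X<\infty\}$ is an r.i. Banach function space, and its fundamental function is $\varphi_X(t)=\|\chi_E\|_X$ for any measurable $E$ with $\mu(E)=t$, defined for $t\in[0,\infty]$ in the range of $\mu$. Let $\phi:\mathcal R\to\mathcal R$ be measurable and satisfy condition (I): there is $A\in(0,\infty)$ with $\mu(\phi^{-n}(E))\le A\mu(E)$ for all $n\ge1$ and all measurable $E$ (power-measure-boundedness), and at least one of the following holds: (I1) the measure-bound of $\phi$, i.e. the least constant $B$ such that $\mu(\phi^{-1}(E))\le B\mu(E)$ for all measurable $E$, is at most $1$; (I2) there is $c>0$ with $c\,\mu(E)\le\mu(\phi^{-i}(E))$ for all $i\in\mathbb N$ and all measurable $E$. Put $T_\phi f=f\circ\phi$ and $T_\phi^{\#}f=\sup_{n\ge1}\frac1n\sum_{i=0}^{n-1}|T_\phi^i f|$ (pointwise). Then for every r.i. Banach function space $X$ over $(\mathcal R,\mu)$ there is a constant $C\in(0,\infty)$, not depending on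 $f$ or $s$, such that for all $f\in X$ and all $s\in[0,\infty)$ $$s\,\varphi_X\big(\mu(\{T_\phi^{\#}f>s\})\big)\le C\,\|f\|_X ,$$ with the convention $0\cdot\infty=0$. -/

import Mathlib

open MeasureTheory Set Filter Topology
open scoped ENNReal NNReal

noncomputable section

namespace RIErgodic

/-! ### Measurable functions, distribution function and rearrangement -/

/-- The extended complex numbers, in which measurable functions take their values. -/
abbrev ExtComplex : Type := OnePoint ℂ

instance instMeasurableSpaceExtComplex : MeasurableSpace ExtComplex := borel ExtComplex

instance instBorelSpaceExtComplex : BorelSpace ExtComplex := ⟨rfl⟩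

/-- The modulus of an extended complex number, with `|∞| = ∞`. -/
def extAbs : ExtComplex → ℝ≥0∞
  | none => ⊤
  | some z => ‖z‖ₑ

/-- The distribution function `s ↦ μ {|f| > s}`; it depends on `f` only through `|f|`, so it is
written for functions with values in `[0, ∞]`. -/
def distribution {α : Type*} [MeasurableSpace α] (μ : Measure α) (f : α → ℝ≥0∞) (s : ℝ≥0) :
    ℝ≥0∞ :=
  μ {x | (s : ℝ≥0∞) < f x}

/-- The non-increasing rearrangement `f*(t) = inf {s ∈ [0, ∞) : f_*(s) ≤ t}`, used for `t ≥ 0`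
(the infimum of the empty set is `∞`). -/
def rearrangement {α : Type*} [MeasurableSpace α] (μ : Measure α) (f : α → ℝ≥0∞) (t : ℝ) : ℝ≥0∞ :=
  ⨅ (s : ℝ≥0) (_ : distribution μ f s ≤ ENNReal.ofReal t), (s : ℝ≥0∞)

/-- Two functions are equimeasurable if their non-increasing rearrangements agree on `[0, ∞)`. -/
def Equimeasurable {α β : Type*} [MeasurableSpace α] [MeasurableSpace β]
    (μ : Measure α) (ν : Measure β) (f : α → ℝ≥0∞) (g : β → ℝ≥0∞) : Prop :=
  ∀ t : ℝ, 0 ≤ t → rearrangement μ f t = rearrangement ν g t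

/-- Resonance: the supremum of `∫ |f g'| dμ` over all `g'` equimeasurable with `g` equals
`∫₀^∞ f* g* dλ`, for all measurable `f`, `g`. All quantities depend only on the moduli of the
functions, which are therefore taken with values in `[0, ∞]`. -/
def IsResonant {α : Type*} [MeasurableSpace α] (μ : Measure α) : Prop :=
  ∀ f g : α → ℝ≥0∞, AEMeasurable f μ → AEMeasurable g μ →
    (⨆ (g' : α → ℝ≥0∞) (_ : AEMeasurable g' μ) (_ : Equimeasurable μ μ g' g),
        ∫⁻ x, f x * g' x ∂μ) =
      ∫⁻ t in Ioi (0 : ℝ), rearrangement μ f t * rearrangement μ g t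

/-! ### Banach function norms -/

/-- A Banach function norm. Since `‖f‖ = ‖|f|‖`, it is given by its values on the non-negative
measurable functions (with values in `[0, ∞]`); the values of `toFun` on non-measurable functions
carry no information and are never used. -/
structure BanachFunctionNorm {α : Type*} [MeasurableSpace α] (μ : Measure α) where
  toFun : (α → ℝ≥0∞) → ℝ≥0∞
  /-- absolute homogeneity -/
  smul' : ∀ (a : ℝ≥0) (f : α → ℝ≥0∞), AEMeasurable f μ →
    toFun (fun x => (a : ℝ≥0∞) * f x) = (a : ℝ≥0∞) * toFun f
  /-- definiteness -/
  eq_zero_iff' : ∀ f : α → ℝ≥0∞, AEMeasurable f μ → (toFun f = 0 ↔ f =ᵐ[μ] 0)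
  /-- subadditivity -/
  add_le' : ∀ f g : α → ℝ≥0∞, AEMeasurable f μ → AEMeasurable g μ →
    toFun (fun x => f x + g x) ≤ toFun f + toFun g
  /-- the lattice property -/
  mono' : ∀ f g : α → ℝ≥0∞, AEMeasurable f μ → AEMeasurable g μ → f ≤ᵐ[μ] g → toFun f ≤ toFun g
  /-- the Fatou property -/
  fatou' : ∀ (f : ℕ → α → ℝ≥0∞) (g : α → ℝ≥0∞), (∀ n, AEMeasurable (f n) μ) → AEMeasurable g μ →
    (∀ᵐ x ∂μ, Monotone fun n => f n x) →
    (∀ᵐ x ∂μ, Tendsto (fun n => f n x) atTop (𝓝 (g x))) →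
    Tendsto (fun n => toFun (f n)) atTop (𝓝 (toFun g))
  /-- characteristic functions of sets of finite measure have finite norm -/
  indicator_lt_top' : ∀ E : Set α, MeasurableSet E → μ E < ⊤ →
    toFun (E.indicator fun _ => 1) < ⊤
  /-- local embedding into `L¹` -/
  setLIntegral_le' : ∀ E : Set α, MeasurableSet E → μ E < ⊤ →
    ∃ C : ℝ≥0, ∀ f : α → ℝ≥0∞, AEMeasurable f μ → ∫⁻ x in E, f x ∂μ ≤ (C : ℝ≥0∞) * toFun f

namespace BanachFunctionNorm

variable {α : Type*} [MeasurableSpace α] {μ : Measure α}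

/-- The norm of an extended complex-valued function. -/
def norm (X : BanachFunctionNorm μ) (f : α → ExtComplex) : ℝ≥0∞ :=
  X.toFun fun x => extAbs (f x)

/-- The Banach function space: all measurable functions of finite norm. -/
def space (X : BanachFunctionNorm μ) : Set (α → ExtComplex) :=
  {f | AEMeasurable f μ ∧ X.norm f < ⊤}

/-- Rearrangement invariance: equimeasurable functions have the same norm. -/
def IsRearrangementInvariant (X : BanachFunctionNorm μ) : Prop :=
  ∀ f g : α → ℝ≥0∞, AEMeasurable f μ → AEMeasurable g μ → Equimeasurable μ μ f g →
    X.toFun f = X.toFun g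

/-- The fundamental function `φ_X(t) = ‖χ_E‖_X`, where `E` is any measurable set with `μ E = t`.
It is meaningful for `t` in the range of `μ` (possibly `t = ∞`), and for rearrangement-invariant
norms the choice of `E` does not matter: see `fundamentalFunction_measure`. -/
def fundamentalFunction (X : BanachFunctionNorm μ) (t : ℝ≥0∞) : ℝ≥0∞ :=
  ⨆ (E : Set α) (_ : MeasurableSet E) (_ : μ E = t), X.toFun (E.indicator fun _ => 1)

end BanachFunctionNorm

theorem equimeasurable_indicator {α : Type*} [MeasurableSpace α] {μ : Measure α} {E F : Set α}
    (h : μ E = μ F) :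
    Equimeasurable μ μ (E.indicator fun _ => 1) (F.indicator fun _ => 1) := by
  have key : ∀ (G : Set α) (s : ℝ≥0), distribution μ (G.indicator fun _ => 1) s =
      if s < 1 then μ G else 0 := by
    intro G s
    unfold distribution
    split_ifs with hs
    · congr 1
      ext x
      by_cases hx : x ∈ G <;> simp [hx, hs]
    · rw [show {x | (s : ℝ≥0∞) < G.indicator (fun _ => 1) x} = ∅ from ?_, measure_empty]
      ext x
      by_cases hx : x ∈ G <;> simp [hx, not_lt.mp hs]
  intro t _
  unfold rearrangement
  simp only [key, h]

theorem BanachFunctionNorm.fundamentalFunction_measure {α : Type*} [MeasurableSpace α]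
    {μ : Measure α} (X : BanachFunctionNorm μ) (hX : X.IsRearrangementInvariant) {E : Set α}
    (hE : MeasurableSet E) :
    X.fundamentalFunction (μ E) = X.toFun (E.indicator fun _ => 1) := by
  apply le_antisymm
  · refine iSup_le fun F => iSup_le fun hF => iSup_le fun h => le_of_eq ?_
    exact hX _ _ (measurable_const.indicator hF).aemeasurable
      (measurable_const.indicator hE).aemeasurable (equimeasurable_indicator h)
  · exact le_iSup_of_le E (le_iSup_of_le hE (le_iSup_of_le rfl le_rfl))

/-! ### Composition operators -/

/-- The composition operator `T_φ f = f ∘ φ`. -/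
def compositionOperator {α : Type*} (φ : α → α) (f : α → ExtComplex) : α → ExtComplex :=
  f ∘ φ

/-- The maximal ergodic operator `sup_{n ≥ 1} (1/n) ∑_{i < n} |T_φ^i f|`, computed pointwise. -/
def maximalErgodic {α : Type*} (φ : α → α) (f : α → ExtComplex) (x : α) : ℝ≥0∞ :=
  ⨆ (n : ℕ) (_ : 1 ≤ n),
    (∑ i ∈ Finset.range n, extAbs ((compositionOperator φ)^[i] f x)) / (n : ℝ≥0∞)

/-- `A ∈ (0, ∞)` satisfies `μ (φ⁻¹ E) ≤ A μ E` for every measurable `E`. -/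
def MeasureBoundedBy {α : Type*} [MeasurableSpace α] (μ : Measure α) (φ : α → α) (A : ℝ≥0) :
    Prop :=
  0 < A ∧ ∀ E : Set α, MeasurableSet E → μ (φ ⁻¹' E) ≤ (A : ℝ≥0∞) * μ E

/-- The measure-bound of `φ`: the least constant `A` with `μ (φ⁻¹ E) ≤ A μ E` for every
measurable `E` (and `∞` if there is none). -/
def measureBound {α : Type*} [MeasurableSpace α] (μ : Measure α) (φ : α → α) : ℝ≥0∞ :=
  ⨅ (A : ℝ≥0) (_ : MeasureBoundedBy μ φ A), (A : ℝ≥0∞)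

/-- Power-measure-boundedness: one constant bounds all the iterates `φ^n`, `n ≥ 1`. -/
def PowerMeasureBounded {α : Type*} [MeasurableSpace α] (μ : Measure α) (φ : α → α) : Prop :=
  ∃ A : ℝ≥0, ∀ n : ℕ, 1 ≤ n → MeasureBoundedBy μ φ^[n] A

/-- Condition (I): `φ` is measurable and power-measure-bounded, and either its measure-bound is at
most `1` or the measures of the preimages under all iterates are uniformly bounded below. -/
def ConditionI {α : Type*} [MeasurableSpace α] (μ : Measure α) (φ : α → α) : Prop :=
  Measurable φ ∧ PowerMeasureBounded μ φ ∧
    (measureBound μ φ ≤ 1 ∨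
      ∃ C : ℝ≥0, 0 < C ∧ ∀ (i : ℕ) (E : Set α), MeasurableSet E →
        (C : ℝ≥0∞) * μ E ≤ μ (φ^[i] ⁻¹' E))

end RIErgodic

end

namespace RIErgodic

/-! ### Layer cake formulas and the rearrangement -/

/-! The estimate combines a weak type (1,1) bound for the maximal operator with a comparison between
the mean of `g*` and the norm of `g`, where `g = |f|`. For `t = μ F` the integral of `g*` over `[0,
t]` is handled as `∫₀^∞ min(t, μ {g > q}) dq`.

Weak type (1,1) follows from Garsia's pointwise inequality (`maxExcess_add_indicator_le`),
integrated along the iterates and telescoped (`maximal_inequality_finite`). Under (I1) a single step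
suffices, because composition with `φ` contracts integrals. Under (I2) one averages over `L` steps
and lets `L → ∞`.

Let `F` have finite measure and lie in `{maximal function of g > 2r}`. Cutting `g` at height `r`
turns the weak type bound into `r t ≤ K ∫₀^t g*` (`mul_measure_le_truncatedIntegral`).

It remains to see that `(1/t) ∫₀^t g* · ‖χ_F‖ ≤ ‖g‖`. If this failed for bounded `g`, some `a χ_F`
with `a` at most the mean of `g*` would lie outside the closed convex set of `u ∈ L²` with `‖u‖_X ≤
‖g‖_X`. A separating `w ∈ L²`, tested against functions equimeasurable with `g`, contradicts
resonance and Chebyshev's inequality for decreasing functions (`toFun_const_indicator_le`).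
Truncation and the Fatou property remove the boundedness of `g` and the finiteness of `μ F`. -/

theorem volume_ofReal_lt (y : ℝ≥0∞) :
    volume ({q : ℝ | ENNReal.ofReal q < y} ∩ Ioi 0) = y := by
  rcases eq_or_ne y ⊤ with rfl | hy
  · simp
  · have : {q : ℝ | ENNReal.ofReal q < y} ∩ Ioi 0 = Ioo 0 y.toReal := by
      ext q
      simp only [mem_inter_iff, mem_ofPred_eq, mem_Ioi, mem_Ioo]
      constructor
      · rintro ⟨h1, h2⟩
        exact ⟨h2, (ENNReal.ofReal_lt_iff_lt_toReal h2.le hy).1 h1⟩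
      · rintro ⟨h1, h2⟩
        exact ⟨(ENNReal.ofReal_lt_iff_lt_toReal h1.le hy).2 h2, h1⟩
    rw [this, Real.volume_Ioo, sub_zero, ENNReal.ofReal_toReal hy]

/-- Tonelli's theorem applied to `f x = ∫₀^∞ 1_{q < f x} dq`. -/
theorem lintegral_mul_eq_lintegral_superlevel {β : Type*} [MeasurableSpace β] (ν : Measure β)
    [SFinite ν] {f h : β → ℝ≥0∞} (hf : Measurable f) (hh : Measurable h) :
    ∫⁻ x, f x * h x ∂ν =
      ∫⁻ q in Ioi (0 : ℝ), ∫⁻ x in {x | ENNReal.ofReal q < f x}, h x ∂ν := by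
  have hS : MeasurableSet {z : β × ℝ | ENNReal.ofReal z.2 < f z.1} :=
    measurableSet_lt (by fun_prop) (by fun_prop)
  have hm : Measurable (Function.uncurry fun (x : β) (q : ℝ) =>
      {x | ENNReal.ofReal q < f x}.indicator h x) := by
    have : (Function.uncurry fun (x : β) (q : ℝ) =>
        {x | ENNReal.ofReal q < f x}.indicator h x) =
        {z : β × ℝ | ENNReal.ofReal z.2 < f z.1}.indicator fun z => h z.1 := by
      ext ⟨x, q⟩
      simp [indicator]
    rw [this]
    exact (hh.comp measurable_fst).indicator hS
  have h1 : ∀ x, f x * h x =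
      ∫⁻ q in Ioi (0 : ℝ), {x | ENNReal.ofReal q < f x}.indicator h x := by
    intro x
    have : (fun q : ℝ => {x | ENNReal.ofReal q < f x}.indicator h x) =
        {q : ℝ | ENNReal.ofReal q < f x}.indicator fun _ => h x := by
      ext q
      simp [indicator]
    have hq : MeasurableSet {q : ℝ | ENNReal.ofReal q < f x} :=
      measurableSet_lt (by fun_prop) (by fun_prop)
    rw [this, lintegral_indicator_const hq, Measure.restrict_apply hq, volume_ofReal_lt, mul_comm]
  simp_rw [h1]
  rw [lintegral_lintegral_swap hm.aemeasurable]
  refine lintegral_congr fun q => ?_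
  rw [lintegral_indicator (measurableSet_lt (by fun_prop) (by fun_prop))]

theorem lintegral_eq_lintegral_measure_superlevel {β : Type*} [MeasurableSpace β] (ν : Measure β)
    [SFinite ν] {f : β → ℝ≥0∞} (hf : Measurable f) :
    ∫⁻ x, f x ∂ν = ∫⁻ q in Ioi (0 : ℝ), ν {x | ENNReal.ofReal q < f x} := by
  simpa using lintegral_mul_eq_lintegral_superlevel ν hf (measurable_const (a := (1 : ℝ≥0∞)))

section Rearrangement

variable {α : Type*} [MeasurableSpace α] {μ : Measure α}

theorem distribution_antitone (μ : Measure α) (g : α → ℝ≥0∞) : Antitone (distribution μ g) :=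
  fun _ _ hab => measure_mono fun _ hx => lt_of_le_of_lt (ENNReal.coe_le_coe.2 hab) hx

/-- The reverse direction is right-continuity of the distribution function: `{g > q}` is the
increasing union of the sets `{g > q + 1/(n+1)}`, so the strict inequality survives at a level
slightly above `q`. -/
theorem lt_rearrangement_iff (μ : Measure α) (g : α → ℝ≥0∞) (q : ℝ≥0) (u : ℝ) :
    (q : ℝ≥0∞) < rearrangement μ g u ↔ ENNReal.ofReal u < distribution μ g q := by
  constructor
  · intro h
    by_contra! hle
    exact absurd (iInf₂_le q hle) (not_le.2 h)
  · intro h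
    have hU : {x | (q : ℝ≥0∞) < g x} = ⋃ n : ℕ, {x | ((q + 1 / ((n : ℝ≥0) + 1) : ℝ≥0) : ℝ≥0∞) < g x} := by
      ext x
      simp only [mem_ofPred_eq, mem_iUnion]
      constructor
      · intro hx
        obtain ⟨r, hr1, hr2⟩ := ENNReal.lt_iff_exists_nnreal_btwn.1 hx
        have hr1 : q < r := by exact_mod_cast hr1
        obtain ⟨n, hn⟩ := exists_nat_one_div_lt (tsub_pos_of_lt hr1)
        refine ⟨n, lt_of_le_of_lt ?_ hr2⟩
        rw [ENNReal.coe_le_coe]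
        calc q + 1 / ((n : ℝ≥0) + 1) ≤ q + (r - q) := by gcongr
          _ = r := add_tsub_cancel_of_le hr1.le
      · rintro ⟨n, hn⟩
        exact lt_of_le_of_lt (by rw [ENNReal.coe_le_coe]; exact le_self_add) hn
    have hmono : Monotone fun n : ℕ =>
        {x | ((q + 1 / ((n : ℝ≥0) + 1) : ℝ≥0) : ℝ≥0∞) < g x} := by
      intro m n hmn x hx
      refine lt_of_le_of_lt ?_ (mem_ofPred_eq ▸ hx)
      rw [ENNReal.coe_le_coe]
      gcongr
    unfold distribution at h
    rw [hU, hmono.measure_iUnion, lt_iSup_iff] at h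
    obtain ⟨n, hn⟩ := h
    refine lt_of_lt_of_le (b := ((q + 1 / ((n : ℝ≥0) + 1) : ℝ≥0) : ℝ≥0∞)) ?_ ?_
    · rw [ENNReal.coe_lt_coe]
      exact lt_add_of_pos_right _ (by positivity)
    · refine le_iInf₂ fun s hs => ?_
      by_contra! hlt
      exact absurd (hn.trans_le ((distribution_antitone μ g
        (by exact_mod_cast hlt.le)).trans hs)) (lt_irrefl _)

theorem measurable_rearrangement (μ : Measure α) (g : α → ℝ≥0∞) :
    Measurable (rearrangement μ g) := by
  refine Antitone.measurable fun a b hab => ?_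
  exact le_iInf₂ fun s hs => iInf₂_le s (hs.trans (ENNReal.ofReal_le_ofReal hab))

/-- Truncated layer cake integral `∫₀^∞ min(t, μ {g > q}) dq`, which is `∫₀^t g*`. -/
noncomputable def truncatedIntegral (μ : Measure α) (t : ℝ≥0∞) (g : α → ℝ≥0∞) : ℝ≥0∞ :=
  ∫⁻ q in Ioi (0 : ℝ), min t (μ {x | ENNReal.ofReal q < g x})

/-- Both sides measure the same region under the graph: by `lt_rearrangement_iff`, the part of `{w*
> p}` where `0 < u < b` is an interval from `0` of length `min(b, μ {w > p})`. -/
theorem setLIntegral_rearrangement (μ : Measure α) (w : α → ℝ≥0∞) (b : ℝ≥0∞) :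
    ∫⁻ u in {u : ℝ | ENNReal.ofReal u < b}, rearrangement μ w u ∂(volume.restrict (Ioi 0)) =
      truncatedIntegral μ b w := by
  rw [lintegral_eq_lintegral_measure_superlevel _ (measurable_rearrangement μ w)]
  refine lintegral_congr fun p => ?_
  have hb : MeasurableSet {u : ℝ | ENNReal.ofReal u < b} :=
    measurableSet_lt (by fun_prop) (by fun_prop)
  rw [Measure.restrict_restrict hb, Measure.restrict_apply
    (measurableSet_lt measurable_const (measurable_rearrangement μ w))]
  have : {u : ℝ | ENNReal.ofReal p < rearrangement μ w u} ∩
      ({u : ℝ | ENNReal.ofReal u < b} ∩ Ioi 0) =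
      {u : ℝ | ENNReal.ofReal u < min b (μ {x | ENNReal.ofReal p < w x})} ∩ Ioi 0 := by
    ext u
    have := lt_rearrangement_iff μ w p.toNNReal u
    simp only [mem_inter_iff, mem_ofPred_eq, lt_min_iff]
    change ENNReal.ofReal p < _ ↔ _ at this
    rw [this]
    change _ < μ {x | ENNReal.ofReal p < w x} ∧ _ ↔ _
    tauto
  rw [this, volume_ofReal_lt]

theorem lintegral_rearrangement_mul (μ : Measure α) (g w : α → ℝ≥0∞) :
    ∫⁻ u in Ioi (0 : ℝ), rearrangement μ g u * rearrangement μ w u =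
      ∫⁻ q in Ioi (0 : ℝ), truncatedIntegral μ (μ {x | ENNReal.ofReal q < g x}) w := by
  rw [lintegral_mul_eq_lintegral_superlevel _ (measurable_rearrangement μ g)
    (measurable_rearrangement μ w)]
  refine lintegral_congr fun q => ?_
  rw [← setLIntegral_rearrangement]
  have : {u : ℝ | ENNReal.ofReal q < rearrangement μ g u} =
      {u : ℝ | ENNReal.ofReal u < μ {x | ENNReal.ofReal q < g x}} := by
    ext u
    exact lt_rearrangement_iff μ g q.toNNReal u
  rw [this]

/-- A Chebyshev type inequality for rearrangements. -/
theorem truncatedIntegral_mul_lintegral_le [SigmaFinite μ] (g : α → ℝ≥0∞) {w : α → ℝ≥0∞}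
    (hw : Measurable w) {F : Set α} (hF : μ F ≠ ⊤) (hwF : ∀ x ∉ F, w x = 0) :
    truncatedIntegral μ (μ F) g * ∫⁻ x, w x ∂μ ≤
      μ F * ∫⁻ u in Ioi (0 : ℝ), rearrangement μ g u * rearrangement μ w u := by
  -- With `t = μ F` and `c = μ {w > p} ≤ t`, this integrates over `p` the elementary inequality
  -- `min(t, b) · c ≤ t · min(b, c)`.
  have key : ∀ b : ℝ≥0∞, min (μ F) b * ∫⁻ x, w x ∂μ ≤ μ F * truncatedIntegral μ b w := by
    intro b
    rw [lintegral_eq_lintegral_measure_superlevel μ hw, truncatedIntegral,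
      ← lintegral_const_mul' _ _ hF,
      ← lintegral_const_mul' _ _ (ne_top_of_le_ne_top hF (min_le_left _ _))]
    refine lintegral_mono fun q => ?_
    have hle : μ {x | ENNReal.ofReal q < w x} ≤ μ F := by
      refine measure_mono fun x hx => ?_
      by_contra hxF
      simp [hwF x hxF] at hx
    rcases le_total b (μ {x | ENNReal.ofReal q < w x}) with h | h
    · rw [min_eq_left h, mul_comm (μ F)]
      exact mul_le_mul' (min_le_right _ _) hle
    · rw [min_eq_right h]
      exact mul_le_mul' (min_le_left _ _) le_rfl
  rw [lintegral_rearrangement_mul, ← lintegral_const_mul' _ _ hF]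
  unfold truncatedIntegral at key ⊢
  refine (lintegral_mul_const'' _ ?_).symm.trans_le (lintegral_mono fun q => key _)
  refine (Antitone.measurable fun a b hab => ?_).aemeasurable
  exact min_le_min_left _ (measure_mono fun x hx =>
    lt_of_le_of_lt (ENNReal.ofReal_le_ofReal hab) hx)


end Rearrangement

/-! ### The fundamental inequality -/

section Fundamental

variable {α : Type*} [MeasurableSpace α] {μ : Measure α}

theorem Equimeasurable.ae_le {f g : α → ℝ≥0∞} (h : Equimeasurable μ μ f g) {M : ℝ≥0}
    (hg : ∀ x, g x ≤ M) : ∀ᵐ x ∂μ, f x ≤ M := by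
  have h0 : ¬ (M : ℝ≥0∞) < rearrangement μ g 0 := by
    rw [lt_rearrangement_iff]
    have : {x | (M : ℝ≥0∞) < g x} = ∅ := eq_empty_of_forall_notMem fun x hx => (hg x).not_gt hx
    simp [distribution, this]
  rw [← h 0 le_rfl, lt_rearrangement_iff] at h0
  simpa [ae_iff, distribution] using h0

/-! ### Balls of the norm inside `L²` and Hahn–Banach separation -/

namespace BanachFunctionNorm

/-- The nonnegative part of the ball of radius `N`, as a set of moduli in `L²`. -/
noncomputable def l2Ball (X : BanachFunctionNorm μ) (N : ℝ≥0∞) : Set (Lp ℝ 2 μ) :=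
  {u | X.toFun (fun x => ‖u x‖ₑ) ≤ N}

theorem mem_l2Ball {X : BanachFunctionNorm μ} {N : ℝ≥0∞} {u : Lp ℝ 2 μ} :
    u ∈ X.l2Ball N ↔ X.toFun (fun x => ‖u x‖ₑ) ≤ N := Iff.rfl

theorem aemeasurable_enorm_Lp (u : Lp ℝ 2 μ) : AEMeasurable (fun x => ‖u x‖ₑ) μ :=
  (Lp.aestronglyMeasurable u).enorm

theorem convex_l2Ball (X : BanachFunctionNorm μ) (N : ℝ≥0∞) : Convex ℝ (X.l2Ball N) := by
  intro u hu v hv a b ha hb hab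
  have hum := aemeasurable_enorm_Lp u
  have hvm := aemeasurable_enorm_Lp v
  have hle : (fun x => ‖(a • u + b • v : Lp ℝ 2 μ) x‖ₑ) ≤ᵐ[μ]
      fun x => (a.toNNReal : ℝ≥0∞) * ‖u x‖ₑ + (b.toNNReal : ℝ≥0∞) * ‖v x‖ₑ := by
    filter_upwards [Lp.coeFn_add (a • u) (b • v), Lp.coeFn_smul a u, Lp.coeFn_smul b v]
      with x h1 h2 h3
    rw [h1, Pi.add_apply, h2, h3, Pi.smul_apply, Pi.smul_apply]
    refine (enorm_add_le _ _).trans_eq ?_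
    rw [enorm_smul, enorm_smul, Real.enorm_of_nonneg ha, Real.enorm_of_nonneg hb]
    rfl
  refine (X.mono' _ _ (aemeasurable_enorm_Lp _) ((hum.const_mul _).add (hvm.const_mul _)) hle).trans
    ((X.add_le' _ _ (hum.const_mul _) (hvm.const_mul _)).trans ?_)
  rw [X.smul' _ _ hum, X.smul' _ _ hvm]
  calc _ ≤ (a.toNNReal : ℝ≥0∞) * N + (b.toNNReal : ℝ≥0∞) * N := by
        gcongr
        · exact hu
        · exact hv
    _ = N := by
        rw [← add_mul, ← ENNReal.coe_add, ← Real.toNNReal_add ha hb, hab]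
        simp

/-- The infima over tails increase to the limit, so the monotone Fatou property yields Fatou's lemma
for arbitrary convergent sequences. -/
theorem toFun_le_of_tendsto (X : BanachFunctionNorm μ) {N : ℝ≥0∞} {f : ℕ → α → ℝ≥0∞}
    {g : α → ℝ≥0∞} (hf : ∀ n, AEMeasurable (f n) μ) (hg : AEMeasurable g μ)
    (hfN : ∀ n, X.toFun (f n) ≤ N)
    (h : ∀ᵐ x ∂μ, Tendsto (fun n => f n x) atTop (𝓝 (g x))) : X.toFun g ≤ N := by
  have hm : ∀ n, AEMeasurable (fun x => ⨅ m : ℕ, f (m + n) x) μ := fun n =>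
    .iInf fun m => hf (m + n)
  refine le_of_tendsto' (X.fatou' (fun n x => ⨅ m : ℕ, f (m + n) x) g hm hg
    (.of_forall fun x => ?_) ?_) fun n => ?_
  · intro a b hab
    refine le_iInf fun m => iInf_le_of_le (m + b - a) ?_
    rw [show m + b - a + a = m + b by omega]
  · filter_upwards [h] with x hx
    have hmono : Monotone fun n => ⨅ m : ℕ, f (m + n) x := by
      intro a b hab
      refine le_iInf fun m => iInf_le_of_le (m + b - a) ?_
      rw [show m + b - a + a = m + b by omega]
    have := tendsto_atTop_iSup hmono
    rwa [← hx.liminf_eq, liminf_eq_iSup_iInf_of_nat']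
  · refine (X.mono' _ _ (hm n) (hf n) (.of_forall fun x => iInf_le_of_le 0 ?_)).trans (hfN n)
    rw [zero_add]

theorem isClosed_l2Ball (X : BanachFunctionNorm μ) (N : ℝ≥0∞) : IsClosed (X.l2Ball N) := by
  refine IsSeqClosed.isClosed fun u v hu huv => ?_
  obtain ⟨ns, -, hns⟩ := (tendstoInMeasure_of_tendsto_Lp huv).exists_seq_tendsto_ae
  refine X.toFun_le_of_tendsto (fun n => aemeasurable_enorm_Lp (u (ns n)))
    (aemeasurable_enorm_Lp v) (fun n => hu (ns n)) ?_
  filter_upwards [hns] with x hx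
  exact hx.enorm

/-- Separation takes place in the Hilbert space `L²`, where functionals are represented by
functions, so no associate space is needed. The bound on `g` and the finite measure of `F` put the
test functions in `L²`. -/
theorem toFun_const_indicator_le [SigmaFinite μ] (hμ : IsResonant μ) (X : BanachFunctionNorm μ)
    (hX : X.IsRearrangementInvariant) {g : α → ℝ≥0∞} (hg : Measurable g) {M : ℝ≥0}
    (hgM : ∀ x, g x ≤ M) {F : Set α} (hF : MeasurableSet F) (hFtop : μ F ≠ ⊤) {a : ℝ≥0}
    (ha : (a : ℝ≥0∞) * μ F ≤ truncatedIntegral μ (μ F) g) :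
    X.toFun (F.indicator fun _ => (a : ℝ≥0∞)) ≤ X.toFun g := by
  rcases eq_or_ne (μ F) 0 with hF0 | hF0
  · have : X.toFun (F.indicator fun _ => (a : ℝ≥0∞)) = 0 :=
      (X.eq_zero_iff' _ (measurable_const.indicator hF).aemeasurable).2
        (indicator_meas_zero hF0)
    rw [this]
    exact zero_le
  set v : Lp ℝ 2 μ := indicatorConstLp 2 hF hFtop (a : ℝ)
  have hvF : v =ᵐ[μ] F.indicator fun _ => (a : ℝ) := indicatorConstLp_coeFn
  by_cases hmem : v ∈ X.l2Ball (X.toFun g)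
  · refine (X.mono' _ _ (measurable_const.indicator hF).aemeasurable (aemeasurable_enorm_Lp v)
      ?_).trans hmem
    filter_upwards [hvF] with x hx
    rw [hx]
    by_cases hxF : x ∈ F <;> simp [hxF]
  exfalso
  obtain ⟨ℓ, γ, hℓ, hγ⟩ :=
    geometric_hahn_banach_closed_point (X.convex_l2Ball _) (X.isClosed_l2Ball _) hmem
  set w : Lp ℝ 2 μ := (InnerProductSpace.toDual ℝ _).symm ℓ
  have hw : ∀ u : Lp ℝ 2 μ, ℓ u = ∫ x, u x * w x ∂μ := by
    intro u
    rw [← InnerProductSpace.toDual_symm_apply (𝕜 := ℝ) (y := ℓ), L2.inner_def]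
    rfl
  have hwm : Measurable w := (Lp.stronglyMeasurable w).measurable
  -- Only the part of `F` where `w` is positive matters: restricting test functions to it keeps them
  -- in the ball, and dropping the rest can only increase the integral of `a χ_F w`.
  set P : Set α := F ∩ {x | 0 < w x}
  have hP : MeasurableSet P := hF.inter (measurableSet_lt measurable_const hwm)
  have hPtop : μ P ≠ ⊤ := ne_top_of_le_ne_top hFtop (measure_mono inter_subset_left)
  set w' : α → ℝ≥0∞ := P.indicator fun x => ENNReal.ofReal (w x) with hw'
  have hwm' : Measurable w' := hwm.ennreal_ofReal.indicator hP
  have hint : ∀ u : Lp ℝ 2 μ, Integrable (fun x => u x * w x) μ := fun u =>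
    L2.integrable_inner (𝕜 := ℝ) w u
  -- upper bound from the elements of the ball
  have hupper : ∫⁻ u in Ioi (0 : ℝ), rearrangement μ g u * rearrangement μ w' u ≤
      ENNReal.ofReal γ := by
    simp_rw [mul_comm (rearrangement μ g _)]
    rw [← hμ w' g hwm'.aemeasurable hg.aemeasurable]
    refine iSup_le fun g' => iSup_le fun hg' => iSup_le fun hgg' => ?_
    have hb := hgg'.ae_le hgM
    have hr : AEStronglyMeasurable (P.indicator fun x => (g' x).toReal) μ :=
      (hg'.ennreal_toReal.indicator hP).aestronglyMeasurable
    have hmL : MemLp (P.indicator fun x => (g' x).toReal) 2 μ := by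
      refine (memLp_indicator_const 2 hP (M : ℝ) (Or.inr hPtop)).mono hr ?_
      filter_upwards [hb] with x hx
      by_cases hxP : x ∈ P
      · have := ENNReal.toReal_mono ENNReal.coe_ne_top hx
        simpa [hxP] using this
      · simp [hxP]
    set u : Lp ℝ 2 μ := hmL.toLp _
    have hu : u =ᵐ[μ] P.indicator fun x => (g' x).toReal := hmL.coeFn_toLp
    have huB : u ∈ X.l2Ball (X.toFun g) := by
      rw [mem_l2Ball, ← hX g' g hg' hg.aemeasurable hgg']
      refine X.mono' _ _ (aemeasurable_enorm_Lp u) hg' ?_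
      filter_upwards [hu, hb] with x hx hbx
      rw [hx]
      by_cases hxP : x ∈ P
      · have := ne_top_of_le_ne_top ENNReal.coe_ne_top hbx
        rw [indicator_of_mem hxP, Real.enorm_of_nonneg ENNReal.toReal_nonneg,
          ENNReal.ofReal_toReal this]
      · simp [hxP]
    have hlt := hℓ u huB
    rw [hw] at hlt
    refine le_trans (le_of_eq ?_) (ENNReal.ofReal_le_ofReal hlt.le)
    have huw : (fun x => u x * w x) =ᵐ[μ] P.indicator fun x => (g' x).toReal * w x := by
      filter_upwards [hu] with x hx
      rw [hx]
      by_cases hxP : x ∈ P <;> simp [hxP]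
    rw [ofReal_integral_eq_lintegral_ofReal (hint u)]
    · refine lintegral_congr_ae ?_
      filter_upwards [huw, hb] with x hx hbx
      rw [hx]
      by_cases hxP : x ∈ P
      · have := ne_top_of_le_ne_top ENNReal.coe_ne_top hbx
        simp only [hw', indicator_of_mem hxP]
        rw [ENNReal.ofReal_mul ENNReal.toReal_nonneg, ENNReal.ofReal_toReal this, mul_comm]
      · simp [hw', hxP]
    · filter_upwards [huw] with x hx
      rw [hx]
      exact indicator_nonneg (fun y hy => mul_nonneg ENNReal.toReal_nonneg hy.2.le) x
  have hlower : ENNReal.ofReal (ℓ v) ≤ a * ∫⁻ x, w' x ∂μ := by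
    rw [hw, ← lintegral_const_mul _ hwm']
    calc ENNReal.ofReal (∫ x, v x * w x ∂μ) ≤ ∫⁻ x, ENNReal.ofReal (v x * w x) ∂μ := by
          rw [integral_eq_lintegral_pos_part_sub_lintegral_neg_part (hint v)]
          refine (ENNReal.ofReal_le_ofReal (sub_le_self _ ENNReal.toReal_nonneg)).trans ?_
          exact ENNReal.ofReal_toReal_le
      _ ≤ ∫⁻ x, a * w' x ∂μ := by
          refine lintegral_mono_ae ?_
          filter_upwards [hvF] with x hx
          rw [hx]
          by_cases hxF : x ∈ F
          · rcases le_or_gt (w x) 0 with h | h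
            · have : (a : ℝ) * w x ≤ 0 := mul_nonpos_of_nonneg_of_nonpos a.2 h
              simp [hxF, ENNReal.ofReal_of_nonpos this]
            · have hxP : x ∈ P := ⟨hxF, h⟩
              rw [indicator_of_mem hxF, hw', indicator_of_mem hxP, ENNReal.ofReal_mul a.coe_nonneg,
                ENNReal.ofReal_coe_nnreal]
          · simp [hxF]
  have hcheb := truncatedIntegral_mul_lintegral_le (μ := μ) g hwm' hFtop
    (fun x hx => indicator_of_notMem (fun h => hx h.1) _)
  have hγ0 : 0 < γ := by
    have h0 : (0 : Lp ℝ 2 μ) ∈ X.l2Ball (X.toFun g) := by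
      refine mem_l2Ball.2 (X.mono' _ _ (aemeasurable_enorm_Lp 0) hg.aemeasurable ?_)
      filter_upwards [Lp.coeFn_zero ℝ 2 μ] with x hx
      rw [hx]
      simp
    simpa using hℓ 0 h0
  -- Separation gave `γ < ℓ v`; the chain yields the opposite inequality once the finite nonzero
  -- factor `μ F` is cancelled.
  have hchain : μ F * ENNReal.ofReal (ℓ v) ≤ μ F * ENNReal.ofReal γ :=
    calc μ F * ENNReal.ofReal (ℓ v) ≤ μ F * (a * ∫⁻ x, w' x ∂μ) := by gcongr
      _ = (a * μ F) * ∫⁻ x, w' x ∂μ := by ring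
      _ ≤ truncatedIntegral μ (μ F) g * ∫⁻ x, w' x ∂μ := by gcongr
      _ ≤ _ := hcheb
      _ ≤ _ := by gcongr
  rw [ENNReal.mul_le_mul_iff_right hF0 hFtop,
    ENNReal.ofReal_le_ofReal_iff hγ0.le] at hchain
  exact hchain.not_gt hγ

theorem toFun_indicator_mul_truncatedIntegral_le_of_bounded [SigmaFinite μ] (hμ : IsResonant μ)
    (X : BanachFunctionNorm μ) (hX : X.IsRearrangementInvariant) {g : α → ℝ≥0∞}
    (hg : Measurable g) {M : ℝ≥0} (hgM : ∀ x, g x ≤ M) {F : Set α} (hF : MeasurableSet F)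
    (hFtop : μ F ≠ ⊤) :
    truncatedIntegral μ (μ F) g * X.toFun (F.indicator fun _ => 1) ≤ μ F * X.toFun g := by
  have h1 : AEMeasurable (F.indicator fun _ => (1 : ℝ≥0∞)) μ :=
    (measurable_const.indicator hF).aemeasurable
  rcases eq_or_ne (μ F) 0 with hF0 | hF0
  · have : X.toFun (F.indicator fun _ => (1 : ℝ≥0∞)) = 0 :=
      (X.eq_zero_iff' _ h1).2 (indicator_meas_zero hF0)
    simp [this]
  have hχtop : X.toFun (F.indicator fun _ => (1 : ℝ≥0∞)) ≠ ⊤ :=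
    (X.indicator_lt_top' F hF hFtop.lt_top).ne
  have hχ0 : X.toFun (F.indicator fun _ => (1 : ℝ≥0∞)) ≠ 0 := by
    rw [Ne, X.eq_zero_iff' _ h1, indicator_ae_eq_zero]
    simpa [Function.support] using hF0
  rw [mul_comm (μ F), ← ENNReal.div_le_iff hF0 hFtop, ENNReal.mul_div_right_comm,
    ← ENNReal.le_div_iff_mul_le (Or.inl hχ0) (Or.inl hχtop)]
  -- Homogeneity concerns finite scalars only, so the mean of `g*` is approached from below by
  -- finite `a`.
  refine ENNReal.le_of_forall_nnreal_lt fun a ha => ?_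
  rw [ENNReal.le_div_iff_mul_le (Or.inl hχ0) (Or.inl hχtop), ← X.smul' _ _ h1]
  have ha' := ((ENNReal.lt_div_iff_mul_lt (Or.inl hF0) (Or.inl hFtop)).1 ha).le
  refine le_trans (le_of_eq ?_) (X.toFun_const_indicator_le hμ hX hg hgM hF hFtop ha')
  congr 1
  ext x
  by_cases hx : x ∈ F <;> simp [hx]

end BanachFunctionNorm

theorem truncatedIntegral_eq_iSup (t : ℝ≥0∞) (g : α → ℝ≥0∞) :
    truncatedIntegral μ t g = ⨆ n : ℕ, truncatedIntegral μ t fun x => min (g x) n := by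
  unfold truncatedIntegral
  rw [← lintegral_iSup]
  · refine lintegral_congr fun q => ?_
    have hU : {x | ENNReal.ofReal q < g x} = ⋃ n : ℕ, {x | ENNReal.ofReal q < min (g x) n} := by
      ext x
      simp only [mem_ofPred_eq, mem_iUnion, lt_min_iff, exists_and_left]
      exact ⟨fun h => ⟨h, ENNReal.exists_nat_gt ENNReal.ofReal_ne_top⟩, fun h => h.1⟩
    have hmono : Monotone fun n : ℕ => {x | ENNReal.ofReal q < min (g x) n} := by
      intro m n hmn x hx
      exact lt_of_lt_of_le (mem_ofPred_eq ▸ hx) (min_le_min_left _ (Nat.cast_le.2 hmn))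
    rw [hU, hmono.measure_iUnion]
    exact inf_iSup_eq _ _
  · intro n
    refine Antitone.measurable fun a b hab => ?_
    exact min_le_min_left _ (measure_mono fun x hx =>
      lt_of_le_of_lt (ENNReal.ofReal_le_ofReal hab) hx)
  · intro m n hmn q
    exact min_le_min_left _ (measure_mono fun x hx =>
      lt_of_lt_of_le (mem_ofPred_eq ▸ hx) (min_le_min_left _ (Nat.cast_le.2 hmn)))

/-- The mean of `g*` over `[0, μ F]`, times the norm of `χ_F`, is at most the norm of `g`. -/
theorem BanachFunctionNorm.truncatedIntegral_mul_toFun_indicator_le [SigmaFinite μ]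
    (hμ : IsResonant μ) (X : BanachFunctionNorm μ) (hX : X.IsRearrangementInvariant)
    {g : α → ℝ≥0∞} (hg : Measurable g) {F : Set α} (hF : MeasurableSet F) (hFtop : μ F ≠ ⊤) :
    truncatedIntegral μ (μ F) g * X.toFun (F.indicator fun _ => 1) ≤ μ F * X.toFun g := by
  rw [truncatedIntegral_eq_iSup, ENNReal.iSup_mul]
  refine iSup_le fun n => ?_
  have hgn : Measurable fun x => min (g x) n := hg.min measurable_const
  refine (X.toFun_indicator_mul_truncatedIntegral_le_of_bounded hμ hX hgn (M := n)
    (fun x => min_le_right _ _) hF hFtop).trans ?_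
  gcongr
  exact X.mono' _ _ hgn.aemeasurable hg.aemeasurable (.of_forall fun x => min_le_left _ _)

end Fundamental

/-! ### The maximal ergodic inequality on `L¹` -/

section Ergodic

variable {α : Type*}

/-- The sum of a function over the first `n` points of an orbit. -/
noncomputable def orbitSum (φ : α → α) (f : α → ℝ≥0∞) (n : ℕ) (x : α) : ℝ≥0∞ :=
  ∑ i ∈ Finset.range n, f (φ^[i] x)

theorem orbitSum_succ' (φ : α → α) (f : α → ℝ≥0∞) (n : ℕ) (x : α) :
    orbitSum φ f (n + 1) x = f x + orbitSum φ f n (φ x) := by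
  rw [orbitSum, Finset.sum_range_succ', add_comm]
  rfl

/-- The largest excess over `n s` of the orbit sums of length `n < N`. -/
noncomputable def maxExcess (φ : α → α) (f : α → ℝ≥0∞) (s : ℝ≥0) (N : ℕ) (x : α) : ℝ≥0∞ :=
  ⨆ n ∈ Finset.range N, (orbitSum φ f n x - n * s)

/-- A positive excess cannot come from `n = 0`. For `n + 1`, removing the first orbit point and one
copy of `s` leaves an excess of length `n` starting at `φ x`, and this is bounded by the maximal
excess there. -/
theorem maxExcess_add_indicator_le (φ : α → α) (f : α → ℝ≥0∞) (s : ℝ≥0) (N : ℕ) (x : α) :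
    maxExcess φ f s N x + {x | 0 < maxExcess φ f s N x}.indicator (fun _ => (s : ℝ≥0∞)) x ≤
      f x + maxExcess φ f s N (φ x) := by
  by_cases hx : 0 < maxExcess φ f s N x
  · rw [indicator_of_mem (by exact hx)]
    have hx' := hx
    rw [maxExcess] at hx'
    obtain ⟨n₀, hn₀⟩ := lt_iSup_iff.1 hx'
    obtain ⟨hn₀N, hn₀⟩ := lt_iSup_iff.1 hn₀
    have step : ∀ n ∈ Finset.range N, 0 < orbitSum φ f n x - n * s →
        orbitSum φ f n x - n * s + s ≤ f x + maxExcess φ f s N (φ x) := by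
      intro n hn hpos
      rcases n with _ | n
      · simp [orbitSum] at hpos
      · have hlt : ((n + 1 : ℕ) : ℝ≥0∞) * s < orbitSum φ f (n + 1) x := tsub_pos_iff_lt.1 hpos
        have e : ((n + 1 : ℕ) : ℝ≥0∞) * s = n * s + s := by push_cast; ring
        have hs : (s : ℝ≥0∞) ≠ ⊤ := ENNReal.coe_ne_top
        rw [e] at hlt ⊢
        have hle : orbitSum φ f (n + 1) x - (n * s + s) + s ≤ orbitSum φ f (n + 1) x - n * s := by
          rw [← tsub_tsub]
          refine (tsub_add_cancel_of_le ?_).le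
          exact ENNReal.le_sub_of_add_le_left (ENNReal.mul_ne_top (by simp) hs) hlt.le
        refine hle.trans ?_
        rw [orbitSum_succ']
        refine add_tsub_le_assoc.trans (add_le_add le_rfl ?_)
        exact le_iSup₂_of_le (f := fun n (_ : n ∈ Finset.range N) => orbitSum φ f n (φ x) - n * s) n
          (Finset.mem_range.2 (by have := Finset.mem_range.1 hn; omega)) le_rfl
    -- This makes the truncated subtraction of `s` from the right-hand side exact.
    have hs : (s : ℝ≥0∞) ≤ f x + maxExcess φ f s N (φ x) :=
      le_add_self.trans (step n₀ hn₀N hn₀)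
    rw [← tsub_add_cancel_of_le hs]
    refine add_le_add (iSup₂_le fun n hn => ?_) le_rfl
    rcases eq_zero_or_pos (orbitSum φ f n x - n * s) with h | h
    · rw [h]; exact zero_le
    · exact ENNReal.le_sub_of_add_le_right ENNReal.coe_ne_top (step n hn h)
  · rw [indicator_of_notMem (by exact hx), add_zero, not_lt.1 hx |>.antisymm zero_le]
    exact zero_le

/-- The maximal ergodic operator on nonnegative functions. -/
noncomputable def maxAverage (φ : α → α) (f : α → ℝ≥0∞) (x : α) : ℝ≥0∞ :=
  ⨆ (n : ℕ) (_ : 1 ≤ n), orbitSum φ f n x / n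

theorem setOf_lt_maxAverage (φ : α → α) (f : α → ℝ≥0∞) (s : ℝ≥0) :
    {x | (s : ℝ≥0∞) < maxAverage φ f x} = ⋃ N, {x | 0 < maxExcess φ f s N x} := by
  ext x
  simp only [mem_ofPred_eq, mem_iUnion, maxAverage, maxExcess, lt_iSup_iff, tsub_pos_iff_lt,
    Finset.mem_range, exists_prop]
  constructor
  · rintro ⟨n, hn, h⟩
    refine ⟨n + 1, n, n.lt_succ_self, ?_⟩
    rwa [mul_comm, ← ENNReal.lt_div_iff_mul_lt (Or.inl (by simp; omega)) (Or.inl (by simp))]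
  · rintro ⟨N, n, -, h⟩
    rcases Nat.eq_zero_or_pos n with rfl | hn
    · simp [orbitSum] at h
    · refine ⟨n, hn, ?_⟩
      rwa [ENNReal.lt_div_iff_mul_lt (Or.inl (by simp; omega)) (Or.inl (by simp)), mul_comm]

variable [MeasurableSpace α] {μ : Measure α}

theorem measurable_orbitSum {φ : α → α} (hφ : Measurable φ) {f : α → ℝ≥0∞} (hf : Measurable f)
    (n : ℕ) : Measurable (orbitSum φ f n) :=
  Finset.measurable_sum _ fun i _ => hf.comp (hφ.iterate i)

theorem measurable_maxExcess {φ : α → α} (hφ : Measurable φ) {f : α → ℝ≥0∞} (hf : Measurable f)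
    (s : ℝ≥0) (N : ℕ) : Measurable (maxExcess φ f s N) :=
  .biSup _ (Finset.countable_toSet _) fun n _ => (measurable_orbitSum hφ hf n).sub_const _

theorem lintegral_comp_iterate_le {φ : α → α} (hφ : Measurable φ) {A : ℝ≥0} (n : ℕ)
    (h : ∀ E, MeasurableSet E → μ (φ^[n] ⁻¹' E) ≤ (A : ℝ≥0∞) * μ E) {g : α → ℝ≥0∞}
    (hg : Measurable g) : ∫⁻ x, g (φ^[n] x) ∂μ ≤ A * ∫⁻ x, g x ∂μ := by
  rw [← lintegral_map hg (hφ.iterate n), ← smul_eq_mul, ← lintegral_smul_measure]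
  refine lintegral_mono' (Measure.le_iff.2 fun E hE => ?_) le_rfl
  rw [Measure.map_apply (hφ.iterate n) hE]
  simpa using h E hE

theorem lintegral_maxExcess_ne_top {φ : α → α} (hφ : Measurable φ) {A : ℝ≥0}
    (hA : ∀ n E, MeasurableSet E → μ (φ^[n] ⁻¹' E) ≤ (A : ℝ≥0∞) * μ E)
    {f : α → ℝ≥0∞} (hf : Measurable f) (hfi : ∫⁻ x, f x ∂μ ≠ ⊤) (s : ℝ≥0) (N : ℕ) :
    ∫⁻ x, maxExcess φ f s N x ∂μ ≠ ⊤ := by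
  have : ∫⁻ x, maxExcess φ f s N x ∂μ ≤ ∑ n ∈ Finset.range N, A * ∫⁻ x, f x ∂μ := by
    calc ∫⁻ x, maxExcess φ f s N x ∂μ ≤ ∫⁻ x, orbitSum φ f N x ∂μ := by
          refine lintegral_mono fun x => iSup₂_le fun n hn => tsub_le_self.trans ?_
          exact Finset.sum_le_sum_of_subset
            (Finset.range_subset_range.2 (Finset.mem_range.1 hn).le)
      _ = ∑ n ∈ Finset.range N, ∫⁻ x, f (φ^[n] x) ∂μ :=
          lintegral_finsetSum _ fun n _ => hf.comp (hφ.iterate n)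
      _ ≤ _ := Finset.sum_le_sum fun n _ => lintegral_comp_iterate_le hφ n (hA n) hf
  refine ne_top_of_le_ne_top ?_ this
  exact ENNReal.sum_ne_top.2 fun n _ => ENNReal.mul_ne_top ENNReal.coe_ne_top hfi

/-- Garsia's inequality at `φ^[i] x`, integrated and summed over `i < L`; the integrals of the
maximal excess telescope. -/
theorem maximal_inequality_finite {φ : α → α} (hφ : Measurable φ) {A : ℝ≥0}
    (hA : ∀ n E, MeasurableSet E → μ (φ^[n] ⁻¹' E) ≤ (A : ℝ≥0∞) * μ E)
    {f : α → ℝ≥0∞} (hf : Measurable f) (hfi : ∫⁻ x, f x ∂μ ≠ ⊤) (s : ℝ≥0) (N L : ℕ) :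
    s * ∑ i ∈ Finset.range L, μ (φ^[i] ⁻¹' {x | 0 < maxExcess φ f s N x}) +
      ∫⁻ x, maxExcess φ f s N x ∂μ ≤
      ∑ i ∈ Finset.range L, ∫⁻ x, f (φ^[i] x) ∂μ + ∫⁻ x, maxExcess φ f s N (φ^[L] x) ∂μ := by
  have hp := measurable_maxExcess hφ hf s N
  have hpi := lintegral_maxExcess_ne_top hφ hA hf hfi s N
  have hpi' : ∀ n, ∫⁻ x, maxExcess φ f s N (φ^[n] x) ∂μ ≠ ⊤ := fun n =>
    ne_top_of_le_ne_top (ENNReal.mul_ne_top ENNReal.coe_ne_top hpi)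
      (lintegral_comp_iterate_le hφ n (hA n) hp)
  have hE : MeasurableSet {x | 0 < maxExcess φ f s N x} :=
    measurableSet_lt measurable_const hp
  have step : ∀ i, ∫⁻ x, maxExcess φ f s N (φ^[i] x) ∂μ +
      s * μ (φ^[i] ⁻¹' {x | 0 < maxExcess φ f s N x}) ≤
      ∫⁻ x, f (φ^[i] x) ∂μ + ∫⁻ x, maxExcess φ f s N (φ^[i + 1] x) ∂μ := by
    intro i
    have hf' : Measurable fun x => f (φ^[i] x) := hf.comp (hφ.iterate i)
    have hp' : Measurable fun x => maxExcess φ f s N (φ^[i] x) := hp.comp (hφ.iterate i)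
    rw [← lintegral_add_left hf', ← lintegral_indicator_const (hφ.iterate i hE),
      ← lintegral_add_left hp']
    refine lintegral_mono fun x => ?_
    rw [Function.iterate_succ_apply']
    exact maxExcess_add_indicator_le φ f s N (φ^[i] x)
  induction L with
  | zero => simp
  | succ L ih =>
    rw [Finset.sum_range_succ, Finset.sum_range_succ, mul_add]
    have h1 := add_le_add ih (step L)
    -- The intermediate boundary integral appears on both sides and cancels because it is finite.
    rw [← ENNReal.add_le_add_iff_right (hpi' L)]
    calc _ = _ := by ring
      _ ≤ _ := h1
      _ = _ := by ring

theorem maximal_inequality_of_contraction {φ : α → α} (hφ : Measurable φ) {A : ℝ≥0}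
    (hA : ∀ n E, MeasurableSet E → μ (φ^[n] ⁻¹' E) ≤ (A : ℝ≥0∞) * μ E)
    (h1 : ∀ E, MeasurableSet E → μ (φ ⁻¹' E) ≤ μ E)
    {f : α → ℝ≥0∞} (hf : Measurable f) (hfi : ∫⁻ x, f x ∂μ ≠ ⊤) (s : ℝ≥0) (N : ℕ) :
    s * μ {x | 0 < maxExcess φ f s N x} ≤ ∫⁻ x, f x ∂μ := by
  have h := maximal_inequality_finite hφ hA hf hfi s N 1
  have h' := lintegral_comp_iterate_le (A := 1) hφ 1 (by simpa using h1)
    (measurable_maxExcess hφ hf s N)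
  simp only [ENNReal.coe_one, one_mul] at h'
  simp only [Finset.sum_range_one, Function.iterate_zero, preimage_id, id] at h
  exact (ENNReal.add_le_add_iff_right (lintegral_maxExcess_ne_top hφ hA hf hfi s N)).1
    (h.trans (add_le_add le_rfl h'))

/-- Each of the `L` preimages of the set has measure at least `c μ E`, while the boundary term stays
bounded by `A` times a fixed finite integral. Dividing by `L` and letting `L → ∞` removes it and
leaves the constant `A / c`. -/
theorem maximal_inequality_of_lower_bound {φ : α → α} (hφ : Measurable φ) {A c : ℝ≥0}
    (hA : ∀ n E, MeasurableSet E → μ (φ^[n] ⁻¹' E) ≤ (A : ℝ≥0∞) * μ E)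
    (hc : 0 < c) (hcE : ∀ n E, MeasurableSet E → (c : ℝ≥0∞) * μ E ≤ μ (φ^[n] ⁻¹' E))
    {f : α → ℝ≥0∞} (hf : Measurable f) (hfi : ∫⁻ x, f x ∂μ ≠ ⊤) (s : ℝ≥0) (N : ℕ) :
    s * μ {x | 0 < maxExcess φ f s N x} ≤ (A / c : ℝ≥0) * ∫⁻ x, f x ∂μ := by
  have hp := measurable_maxExcess hφ hf s N
  have hE : MeasurableSet {x | 0 < maxExcess φ f s N x} := measurableSet_lt measurable_const hp
  have hpi := lintegral_maxExcess_ne_top hφ hA hf hfi s N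
  set E := {x | 0 < maxExcess φ f s N x}
  have key : ∀ L : ℕ, (L : ℝ≥0∞) * (s * (c * μ E)) ≤
      L * (A * ∫⁻ x, f x ∂μ) + A * ∫⁻ x, maxExcess φ f s N x ∂μ := by
    intro L
    have h := le_self_add.trans (maximal_inequality_finite hφ hA hf hfi s N L)
    calc (L : ℝ≥0∞) * (s * (c * μ E)) = s * ∑ i ∈ Finset.range L, c * μ E := by
          simp only [Finset.sum_const, Finset.card_range, nsmul_eq_mul]; ring
      _ ≤ s * ∑ i ∈ Finset.range L, μ (φ^[i] ⁻¹' E) := by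
          gcongr with i _
          exact hcE i E hE
      _ ≤ _ := h
      _ ≤ ∑ i ∈ Finset.range L, A * ∫⁻ x, f x ∂μ + A * ∫⁻ x, maxExcess φ f s N x ∂μ :=
          add_le_add (Finset.sum_le_sum fun i _ => lintegral_comp_iterate_le hφ i (hA i) hf)
            (lintegral_comp_iterate_le hφ L (hA L) hp)
      _ = _ := by simp only [Finset.sum_const, Finset.card_range, nsmul_eq_mul]
  have hlim : s * (c * μ E) ≤ A * ∫⁻ x, f x ∂μ := by
    refine ge_of_tendsto' (f := fun L : ℕ => A * ∫⁻ x, f x ∂μ +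
      (A * ∫⁻ x, maxExcess φ f s N x ∂μ) / ((L + 1 : ℕ) : ℝ≥0∞)) (x := atTop) ?_ fun L => ?_
    · have h0 : Tendsto (fun L : ℕ => (A * ∫⁻ x, maxExcess φ f s N x ∂μ) /
          ((L + 1 : ℕ) : ℝ≥0∞)) atTop (𝓝 0) := by
        have hA' : A * ∫⁻ x, maxExcess φ f s N x ∂μ ≠ ⊤ := ENNReal.mul_ne_top ENNReal.coe_ne_top hpi
        simpa using ENNReal.Tendsto.const_div
          (ENNReal.tendsto_nat_nhds_top.comp (tendsto_add_atTop_nat 1)) (Or.inr hA')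
      simpa using tendsto_const_nhds.add h0
    · have hL : ((L + 1 : ℕ) : ℝ≥0∞) ≠ 0 := by simp
      have hL' : ((L + 1 : ℕ) : ℝ≥0∞) ≠ ⊤ := ENNReal.natCast_ne_top _
      rw [← ENNReal.mul_le_mul_iff_right hL hL', mul_add, ENNReal.mul_div_cancel hL hL']
      exact key (L + 1)
  have hc0 : (c : ℝ≥0∞) ≠ 0 := by exact_mod_cast hc.ne'
  rw [← ENNReal.mul_le_mul_iff_right hc0 ENNReal.coe_ne_top, ENNReal.coe_div hc.ne',
    ← mul_assoc (c : ℝ≥0∞) (_ / _), ENNReal.mul_div_cancel hc0 ENNReal.coe_ne_top]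
  calc _ = s * (c * μ E) := by ring
    _ ≤ _ := hlim

theorem measurable_maxAverage {φ : α → α} (hφ : Measurable φ) {f : α → ℝ≥0∞}
    (hf : Measurable f) : Measurable (maxAverage φ f) :=
  .iSup fun n => .iSup fun _ => (measurable_orbitSum hφ hf n).div_const _

theorem measure_lt_maxAverage_le {φ : α → α} {K : ℝ≥0∞} {f : α → ℝ≥0∞} {s : ℝ≥0}
    (h : ∀ N, s * μ {x | 0 < maxExcess φ f s N x} ≤ K) :
    s * μ {x | (s : ℝ≥0∞) < maxAverage φ f x} ≤ K := by
  have hmono : Monotone fun N => {x | 0 < maxExcess φ f s N x} := by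
    intro M N hMN x hx
    refine lt_of_lt_of_le (mem_ofPred_eq ▸ hx) ?_
    exact biSup_mono fun n hn => Finset.range_subset_range.2 hMN hn
  rw [setOf_lt_maxAverage, hmono.measure_iUnion, ENNReal.mul_iSup]
  exact iSup_le h

/-- Every `b > 1` exceeds an admissible constant; letting `b` decrease to `1` avoids showing that
the infimum is attained. -/
theorem measure_preimage_le_of_measureBound_le_one {φ : α → α} (h : measureBound μ φ ≤ 1)
    {E : Set α} (hE : MeasurableSet E) : μ (φ ⁻¹' E) ≤ μ E := by
  have hlt : ∀ b : ℝ≥0∞, 1 < b → μ (φ ⁻¹' E) ≤ b * μ E := by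
    intro b hb
    obtain ⟨A, hA⟩ := iInf_lt_iff.1 (h.trans_lt hb)
    obtain ⟨hA, hAb⟩ := iInf_lt_iff.1 hA
    exact (hA.2 E hE).trans (mul_le_mul' hAb.le le_rfl)
  rcases eq_or_ne (μ E) ⊤ with htop | htop
  · simp [htop]
  have hcont : Tendsto (fun b : ℝ≥0∞ => b * μ E) (𝓝[>] 1) (𝓝 (1 * μ E)) :=
    (ENNReal.Tendsto.mul_const tendsto_id (Or.inl one_ne_zero)).mono_left nhdsWithin_le_nhds
  rw [one_mul] at hcont
  have : (𝓝[>] (1 : ℝ≥0∞)).NeBot := nhdsGT_neBot_of_exists_gt ⟨2, by norm_num⟩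
  exact ge_of_tendsto hcont (eventually_nhdsWithin_of_forall fun b hb => hlt b hb)

/-- Weak type `(1, 1)` of the maximal ergodic operator. -/
theorem ConditionI.exists_weak_type {φ : α → α} (h : ConditionI μ φ) :
    ∃ K : ℝ≥0, 1 ≤ K ∧ ∀ f : α → ℝ≥0∞, Measurable f → ∀ s : ℝ≥0,
      s * μ {x | (s : ℝ≥0∞) < maxAverage φ f x} ≤ K * ∫⁻ x, f x ∂μ := by
  obtain ⟨hφ, ⟨A, hA⟩, h⟩ := h
  -- The maximum with `1` also covers the iterate `n = 0`.
  have hA' : ∀ n E, MeasurableSet E → μ (φ^[n] ⁻¹' E) ≤ ((max A 1 : ℝ≥0) : ℝ≥0∞) * μ E := by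
    intro n E hE
    rcases n with _ | n
    · calc μ (φ^[0] ⁻¹' E) = ((1 : ℝ≥0) : ℝ≥0∞) * μ E := by simp
        _ ≤ _ := by gcongr; exact le_max_right _ _
    · refine ((hA (n + 1) (by omega)).2 E hE).trans ?_
      gcongr
      exact le_max_left _ _
  suffices ∃ K : ℝ≥0, ∀ f : α → ℝ≥0∞, Measurable f → ∫⁻ x, f x ∂μ ≠ ⊤ → ∀ (s : ℝ≥0) (N : ℕ),
      s * μ {x | 0 < maxExcess φ f s N x} ≤ K * ∫⁻ x, f x ∂μ by
    obtain ⟨K, hK⟩ := this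
    -- A nonzero constant makes the right-hand side infinite when `∫ f = ∞`; `1 ≤ K` is used again
    -- when passing to the rearrangement.
    refine ⟨max K 1, le_max_right _ _, fun f hf s => ?_⟩
    rcases eq_or_ne (∫⁻ x, f x ∂μ) ⊤ with htop | hfi
    · have : ((max K 1 : ℝ≥0) : ℝ≥0∞) ≠ 0 := by
        exact_mod_cast (zero_lt_one.trans_le (le_max_right K 1)).ne'
      rw [htop, ENNReal.mul_top this]
      exact le_top
    · refine (measure_lt_maxAverage_le (hK f hf hfi s)).trans ?_
      gcongr
      exact le_max_left _ _
  rcases h with h | ⟨c, hc, hcE⟩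
  · refine ⟨1, fun f hf hfi s N => ?_⟩
    rw [ENNReal.coe_one, one_mul]
    exact maximal_inequality_of_contraction hφ hA'
      (fun E hE => measure_preimage_le_of_measureBound_le_one h hE) hf hfi s N
  · exact ⟨_, fun f hf hfi s N => maximal_inequality_of_lower_bound hφ hA' hc hcE hf hfi s N⟩

end Ergodic

/-! ### The weak type estimate in a rearrangement-invariant space -/

section WeakType

theorem maximalErgodic_eq_maxAverage {α : Type*} (φ : α → α) (f : α → ExtComplex) :
    maximalErgodic φ f = maxAverage φ fun x => extAbs (f x) := by
  have h : ∀ i : ℕ, (compositionOperator φ)^[i] f = f ∘ φ^[i] := by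
    intro i
    induction i with
    | zero => rfl
    | succ i ih => rw [Function.iterate_succ_apply', ih, Function.iterate_succ]; rfl
  ext x
  simp only [maximalErgodic, maxAverage, orbitSum, h, Function.comp_apply]

theorem measurable_extAbs : Measurable extAbs := by
  refine measurable_of_Ioi fun a => ?_
  induction a with
  | top => simp
  | coe a =>
    -- A closed ball of `ℂ` is compact, so its image is closed in the one-point compactification.
    have : extAbs ⁻¹' Ioi (a : ℝ≥0∞) = ((↑) '' Metric.closedBall (0 : ℂ) a : Set ExtComplex)ᶜ := by
      ext z
      induction z using OnePoint.rec with
      | infty =>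
        have : extAbs OnePoint.infty = ⊤ := rfl
        simp [this]
      | coe z =>
        have : extAbs (z : ExtComplex) = ‖z‖ₑ := rfl
        simp [this, enorm_eq_nnnorm, ← NNReal.coe_lt_coe]
    rw [this]
    exact (OnePoint.isClosed_image_coe.2
      ⟨Metric.isClosed_closedBall, isCompact_closedBall _ _⟩).measurableSet.compl

theorem maxAverage_le_maxAverage_tsub_add {α : Type*} (φ : α → α) (g : α → ℝ≥0∞) (r : ℝ≥0) (x : α) :
    maxAverage φ g x ≤ maxAverage φ (fun x => g x - r) x + r := by
  refine iSup₂_le fun n hn => ?_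
  have hn0 : (n : ℝ≥0∞) ≠ 0 := by simp; omega
  have h : orbitSum φ g n x ≤ orbitSum φ (fun x => g x - r) n x + n * r := by
    calc orbitSum φ g n x ≤ ∑ i ∈ Finset.range n, ((g (φ^[i] x) - r) + r) :=
          Finset.sum_le_sum fun i _ => le_tsub_add
      _ = _ := by simp [orbitSum, Finset.sum_add_distrib]
  calc orbitSum φ g n x / n ≤ (orbitSum φ (fun x => g x - r) n x + n * r) / n := by gcongr
    _ = orbitSum φ (fun x => g x - r) n x / n + r := by
      rw [ENNReal.add_div, mul_comm (n : ℝ≥0∞), ENNReal.mul_div_cancel_right hn0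
        (ENNReal.natCast_ne_top n)]
    _ ≤ _ := by
      gcongr
      exact le_iSup₂_of_le (f := fun (n : ℕ) (_ : 1 ≤ n) =>
        orbitSum φ (fun x => g x - r) n x / n) n hn le_rfl

variable {α : Type*} [MeasurableSpace α] {μ : Measure α}

theorem PowerMeasureBounded.maxAverage_congr_ae {φ : α → α} (hφ : Measurable φ)
    (h : PowerMeasureBounded μ φ) {f g : α → ℝ≥0∞} (hfg : f =ᵐ[μ] g) :
    maxAverage φ f =ᵐ[μ] maxAverage φ g := by
  obtain ⟨A, hA⟩ := h
  have hq : ∀ i : ℕ, (fun x => f (φ^[i] x)) =ᵐ[μ] fun x => g (φ^[i] x) := by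
    intro i
    rcases i with _ | i
    · exact hfg
    · have : Measure.QuasiMeasurePreserving φ^[i + 1] μ μ := by
        refine ⟨hφ.iterate _, Measure.AbsolutelyContinuous.mk fun E hE h0 => ?_⟩
        rw [Measure.map_apply (hφ.iterate _) hE]
        have := (hA (i + 1) (by omega)).2 E hE
        simpa [h0] using this
      exact this.ae_eq_comp hfg
  filter_upwards [ae_all_iff.2 hq] with x hx
  simp only [maxAverage, orbitSum, hx]

theorem mul_measure_le_truncatedIntegral [SFinite μ] {φ : α → α} {K : ℝ≥0} (hK1 : 1 ≤ K)
    (hK : ∀ f : α → ℝ≥0∞, Measurable f → ∀ s : ℝ≥0,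
      s * μ {x | (s : ℝ≥0∞) < maxAverage φ f x} ≤ K * ∫⁻ x, f x ∂μ)
    {g : α → ℝ≥0∞} (hg : Measurable g) {r : ℝ≥0} {F : Set α}
    (hF : F ⊆ {x | ((r + r : ℝ≥0) : ℝ≥0∞) < maxAverage φ g x}) :
    r * μ F ≤ K * truncatedIntegral μ (μ F) g := by
  rcases le_total (μ F) (μ {x | (r : ℝ≥0∞) < g x}) with h | h
  -- Here `μ {g > q} ≥ μ F` for every `q < r`, so the minimum is `μ F` on all of `(0, r)`.
  · calc r * μ F = 1 * ∫⁻ q in Ioo (0 : ℝ) r, μ F := by simp [mul_comm]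
      _ ≤ K * ∫⁻ q in Ioo (0 : ℝ) r, min (μ F) (μ {x | ENNReal.ofReal q < g x}) := by
          refine mul_le_mul' ?_ ?_
          · exact_mod_cast hK1
          · refine setLIntegral_mono' measurableSet_Ioo fun q hq => le_min le_rfl (h.trans ?_)
            refine measure_mono fun x hx => lt_of_le_of_lt (b := (r : ℝ≥0∞)) ?_ hx
            exact ENNReal.ofReal_le_of_le_toReal hq.2.le
      _ ≤ _ := by
          gcongr
          exact lintegral_mono_set Ioo_subset_Ioi_self
  -- Here the excess of `g` over `r` lives on a set of measure at most `μ F`, so its layer cake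
  -- integral is unaffected by truncation at `μ F`. Subtracting `r` lowers the maximal function by
  -- at most `r`, which is why `F` is taken above level `r + r`.
  · have hk : Measurable fun x => g x - r := hg.sub_const _
    calc r * μ F ≤ r * μ {x | (r : ℝ≥0∞) < maxAverage φ (fun x => g x - r) x} := by
          gcongr
          intro x hx
          have h1 := (mem_ofPred_eq ▸ hF hx : _ < _).trans_le
            (maxAverage_le_maxAverage_tsub_add φ g r x)
          rw [ENNReal.coe_add] at h1
          exact lt_of_add_lt_add_right h1
      _ ≤ K * ∫⁻ x, (g x - r) ∂μ := hK _ hk r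
      _ ≤ K * truncatedIntegral μ (μ F) g := by
          gcongr
          rw [lintegral_eq_lintegral_measure_superlevel μ hk]
          refine setLIntegral_mono' measurableSet_Ioi fun q hq => le_min ?_ ?_
          · refine le_trans (measure_mono fun x hx => ?_) h
            exact tsub_pos_iff_lt.1 (lt_of_le_of_lt zero_le (mem_ofPred_eq ▸ hx))
          · exact measure_mono fun x hx => lt_of_lt_of_le (mem_ofPred_eq ▸ hx) tsub_le_self

/-- Exhaustion of `D` by its intersections with the spanning sets, followed by the Fatou property;
this covers `μ D = ∞`. -/
theorem BanachFunctionNorm.toFun_indicator_le_of_finite [SigmaFinite μ] (X : BanachFunctionNorm μ)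
    {N : ℝ≥0∞} {s : ℝ≥0} {D : Set α} (hD : MeasurableSet D)
    (h : ∀ F ⊆ D, MeasurableSet F → μ F ≠ ⊤ → s * X.toFun (F.indicator fun _ => 1) ≤ N) :
    s * X.toFun (D.indicator fun _ => 1) ≤ N := by
  have hm : ∀ {E : Set α}, MeasurableSet E → AEMeasurable (E.indicator fun _ => (1 : ℝ≥0∞)) μ :=
    fun hE => (measurable_const.indicator hE).aemeasurable
  have hDn : ∀ n, MeasurableSet (D ∩ spanningSets μ n) := fun n =>
    hD.inter (measurableSet_spanningSets μ n)
  have hmono : Monotone fun n => D ∩ spanningSets μ n := fun m n hmn =>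
    inter_subset_inter_right _ (monotone_spanningSets μ hmn)
  rw [← X.smul' _ _ (hm hD)]
  refine X.toFun_le_of_tendsto (f := fun n x => s * (D ∩ spanningSets μ n).indicator
    (fun _ => 1) x) (fun n => (hm (hDn n)).const_mul _) ((hm hD).const_mul _) (fun n => ?_) ?_
  · rw [X.smul' _ _ (hm (hDn n))]
    exact h _ inter_subset_left (hDn n)
      (ne_top_of_le_ne_top (measure_spanningSets_lt_top μ n).ne (measure_mono inter_subset_right))
  · refine .of_forall fun x => ENNReal.Tendsto.const_mul ?_ (Or.inr ENNReal.coe_ne_top)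
    have := hmono.tendsto_indicator _ (fun _ => (1 : ℝ≥0∞)) x
    rw [← inter_iUnion, iUnion_spanningSets, inter_univ] at this
    exact this.mono_right (pure_le_nhds _)

theorem ConditionI.exists_toFun_weak_type [SigmaFinite μ] (hμ : IsResonant μ) {φ : α → α}
    (hφ : ConditionI μ φ) (X : BanachFunctionNorm μ) (hX : X.IsRearrangementInvariant) :
    ∃ C : ℝ≥0, 0 < C ∧ ∀ g : α → ℝ≥0∞, Measurable g → ∀ s : ℝ≥0,
      s * X.toFun ({x | (s : ℝ≥0∞) < maxAverage φ g x}.indicator fun _ => 1) ≤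
        C * X.toFun g := by
  obtain ⟨K, hK1, hK⟩ := hφ.exists_weak_type
  -- The factor `2` comes from splitting the level as `s = s/2 + s/2`.
  refine ⟨2 * K, by positivity, fun g hg s => ?_⟩
  refine X.toFun_indicator_le_of_finite
    (measurableSet_lt measurable_const (measurable_maxAverage hφ.1 hg)) fun F hFD hF hFtop => ?_
  rcases eq_or_ne (μ F) 0 with hF0 | hF0
  · have : X.toFun (F.indicator fun _ => (1 : ℝ≥0∞)) = 0 :=
      (X.eq_zero_iff' _ (measurable_const.indicator hF).aemeasurable).2 (indicator_meas_zero hF0)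
    simp [this]
  have hs : s = s / 2 + s / 2 := (add_halves s).symm
  rw [hs] at hFD
  have h1 := mul_measure_le_truncatedIntegral hK1 hK hg hFD
  have h2 := X.truncatedIntegral_mul_toFun_indicator_le hμ hX hg hF hFtop
  rw [← ENNReal.mul_le_mul_iff_right hF0 hFtop]
  set y := X.toFun (F.indicator fun _ => (1 : ℝ≥0∞))
  calc μ F * (s * y) = 2 * (((s / 2 : ℝ≥0) : ℝ≥0∞) * μ F) * y := by
        nth_rw 1 [hs]
        push_cast
        ring
    _ ≤ 2 * (K * truncatedIntegral μ (μ F) g) * y := by gcongr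
    _ = 2 * K * (truncatedIntegral μ (μ F) g * y) := by ring
    _ ≤ 2 * K * (μ F * X.toFun g) := by gcongr
    _ = _ := by push_cast; ring

end WeakType

end RIErgodic

/-! ### Passage to extended complex-valued functions -/

theorem mainTheorem9 {α : Type*} [MeasurableSpace α] (μ : MeasureTheory.Measure α)
    [MeasureTheory.SigmaFinite μ] (hμ : RIErgodic.IsResonant μ)
    (φ : α → α) (hφ : RIErgodic.ConditionI μ φ)
    (X : RIErgodic.BanachFunctionNorm μ) (hX : X.IsRearrangementInvariant) :
    ∃ C : ℝ≥0, 0 < C ∧ ∀ f ∈ X.space, ∀ s : ℝ≥0,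
      (s : ℝ≥0∞) * X.fundamentalFunction
          (μ {x | (s : ℝ≥0∞) < RIErgodic.maximalErgodic φ f x}) ≤
        (C : ℝ≥0∞) * X.norm f := by
  obtain ⟨C, hC, h⟩ := hφ.exists_toFun_weak_type hμ X hX
  refine ⟨C, hC, fun f hf s => ?_⟩
  have hfm : AEMeasurable (fun x => RIErgodic.extAbs (f x)) μ :=
    RIErgodic.measurable_extAbs.comp_aemeasurable hf.1
  -- Null sets have null preimages under all iterates, so replacing `|f|` by a measurable
  -- representative changes the maximal function only on a null set.
  have hae := hφ.2.1.maxAverage_congr_ae hφ.1 hfm.ae_eq_mk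
  have hmeas : μ {x | (s : ℝ≥0∞) < RIErgodic.maximalErgodic φ f x} =
      μ {x | (s : ℝ≥0∞) < RIErgodic.maxAverage φ (hfm.mk _) x} := by
    rw [RIErgodic.maximalErgodic_eq_maxAverage]
    refine measure_congr ?_
    filter_upwards [hae] with x hx
    exact congrArg (fun y => (s : ℝ≥0∞) < y) hx
  rw [hmeas, X.fundamentalFunction_measure hX
    (measurableSet_lt measurable_const (RIErgodic.measurable_maxAverage hφ.1 hfm.measurable_mk))]
  refine (h _ hfm.measurable_mk s).trans ?_
  gcongr
  exact X.mono' _ _ hfm.measurable_mk.aemeasurable hfm hfm.ae_eq_mk.symm.le
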